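/- Let $\mathcal H=L^2([0,1])$ with its usual inner product, let $\psi:[0,1]^2\to\mathbb R$ be continuous, symmetric and positive (i.e. $\iint\psi(t,s)f(s)f(t)\,ds\,dt\ge 0$ for all $f\in\mathcal H$), and let $\Psi(f)(t)=\int_0^1\psi(t,s)f(s)\,ds$ be its integral operator on $\mathcal H$, with $\|\Psi\|<1$. Let $(\varphi_k)_{k\ge1}$ be an orthonormal basis of $\mathcal H$ consisting of eigenfunctions, $\Psi\varphi_k=\lambda_k\varphi_k$. Let $(\chi_n)_{n\ge0}$ be a weakly stationary $\mathcal H$-valued process (finite second moments, constant mean, covariance operators $f\mapsto E[\langle\chi_m-E\chi_m,f\rangle(\chi_n-E\chi_n)]$ depending only on $m-n$) with $$\chi_n=\Psi(\chi_{n-1})+\epsilon_n\quad\text{a.s.},\qquad n\ge1,$$ where $(\epsilon_n)_{n\ge1}$ is a zero-mean white noise in $\mathcal H$ (second moments $0<E\|\epsilon_n\|^2<\infty$, covariance operator not depending on $n$, $E[\langle\epsilon_m,f\rangle\epsilon_n]=0$ for all $f\in\mathcal H$ and $m\ne n$). Put $\eta_k^2=E[\langle\epsilon_n,\varphi_k\rangle^2]$,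 which does not depend on $n$. Then $0\le\lambda_k<1$ for all $k$. The trace-covariance $\sigma_{\mathrm{tr}}(h)=E[\langle\chi_{m+h}-E\chi_{m+h},\chi_m-E\chi_m\rangle]$ does not depend on $m\ge 0$, and for every $h\ge0$ (with $0^0=1$) $$\sigma_{\mathrm{tr}}(h)=\sum_{k=1}^\infty\lambda_k^h\,\frac{\eta_k^2}{1-\lambda_k^2}<\infty .$$ The numbers $$p_k=\frac{\eta_k^2}{1-\lambda_k^2}\Bigl(\sum_{r=1}^\infty\frac{\eta_r^2}{1-\lambda_r^2}\Bigr)^{-1}$$ are non-negative with $\sum_kp_k=1$. For every $n\ge1$, let $$\mathrm{ESS}_{\mathcal F}=n^2\sigma_{\mathrm{tr}}(0)\Bigl(\sum_{i=1}^n\sum_{j=1}^n\sigma_{\mathrm{tr}}(|i-j|)\Bigr)^{-1},\qquad \mathrm{ESS}_k=n^2\Bigl(\sum_{i=1}^n\sum_{j=1}^n\lambda_k^{|i-j|}\Bigr)^{-1}$$ be the functional effective sample size of $\chi_1,\dots,\chi_n$ and the AR(1) effective sample size with coefficient $\lambda_k$. These are positive. Whenever $\eta_k\ne0$, $\mathrm{ESS}_k$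 is the effective sample size $n^2\bigl(\sum_{i=1}^n\sum_{j=1}^n\mathrm{corr}(X_i,X_j)\bigr)^{-1}$ of the scalar process $X_m=\langle\chi_m,\varphi_k\rangle$. Moreover, $\sum_k p_k/\mathrm{ESS}_k$ converges and $$\mathrm{ESS}_{\mathcal F}=\Bigl(\sum_{k=1}^\infty\frac{p_k}{\mathrm{ESS}_k}\Bigr)^{-1}.$$ -/

import Mathlib

open MeasureTheory ProbabilityTheory

noncomputable section

/-- The real Hilbert space `L²([0,1])` (Lebesgue measure on the unit interval). -/
abbrev L2I : Type := Lp ℝ 2 (volume : Measure unitInterval)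

/-- A continuous, symmetric kernel on `[0,1]²` that is positive, in the sense that
`∫∫ ψ(t,s) f(s) f(t) ds dt ≥ 0` for all `f ∈ L²([0,1])`. -/
structure IsPositiveKernel (ψ : unitInterval → unitInterval → ℝ) : Prop where
  continuous : Continuous (Function.uncurry ψ)
  symmetric : ∀ t s, ψ t s = ψ s t
  positive : ∀ f : L2I, 0 ≤ ∫ t, ∫ s, ψ t s * f s * f t

/-- `Ψ` is the integral operator with kernel `ψ`: `Ψ(f)(t) = ∫₀¹ ψ(t,s) f(s) ds` for a.e. `t`. -/
def IsIntegralOperator (ψ : unitInterval → unitInterval → ℝ) (Ψ : L2I →L[ℝ] L2I) : Prop :=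
  ∀ f : L2I, ∀ᵐ t : unitInterval, Ψ f t = ∫ s, ψ t s * f s

/-- The covariance operator `f ↦ E[⟨X - E X, f⟩ (Y - E Y)]` of two random elements of `L²([0,1])`. -/
def covOp {Ω : Type*} [MeasurableSpace Ω] (P : Measure Ω) (X Y : Ω → L2I) (f : L2I) : L2I :=
  ∫ ω, inner ℝ (X ω - ∫ ω', X ω' ∂P) f • (Y ω - ∫ ω', Y ω' ∂P) ∂P

/-- The trace-covariance `E⟨X - E X, Y - E Y⟩` of two random elements of `L²([0,1])`. -/
def traceCov {Ω : Type*} [MeasurableSpace Ω] (P : Measure Ω) (X Y : Ω → L2I) : ℝ :=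
  ∫ ω, inner ℝ (X ω - ∫ ω', X ω' ∂P) (Y ω - ∫ ω', Y ω' ∂P) ∂P

/-- Weak stationarity of a functional time series: finite second moments, constant mean, and
covariance operators that depend on the two time points only through their difference. -/
structure IsWeaklyStationary {Ω : Type*} [MeasurableSpace Ω] (P : Measure Ω)
    (χ : ℕ → Ω → L2I) : Prop where
  memLp : ∀ n, MemLp (χ n) 2 P
  mean : ∃ m : L2I, ∀ n, ∫ ω, χ n ω ∂P = m
  cov : ∀ a b a' b' : ℕ, (a : ℤ) - b = (a' : ℤ) - b' →
    covOp P (χ a) (χ b) = covOp P (χ a') (χ b')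

/-- Zero-mean white noise in `L²([0,1])`: finite and nonzero second moments, mean zero, the same
covariance operator at all times, and no correlation between different times. -/
structure IsWhiteNoise {Ω : Type*} [MeasurableSpace Ω] (P : Measure Ω)
    (ε : ℕ → Ω → L2I) : Prop where
  memLp : ∀ n, MemLp (ε n) 2 P
  mean : ∀ n, ∫ ω, ε n ω ∂P = 0
  nondegenerate : ∀ n, 0 < ∫ ω, ‖ε n ω‖ ^ 2 ∂P
  cov : ∀ m n, covOp P (ε m) (ε m) = covOp P (ε n) (ε n)
  uncorrelated : ∀ m n, m ≠ n → covOp P (ε m) (ε n) = 0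

/-- `χ` is a weakly stationary FAR(1) process `χ_n = Ψ(χ_{n-1}) + ε_n`, `n ≥ 1`, driven by the
white noise `ε_1, ε_2, …` (the value `ε 0` plays no role). -/
structure IsStationaryFAR1 {Ω : Type*} [MeasurableSpace Ω] (P : Measure Ω)
    (Ψ : L2I →L[ℝ] L2I) (χ ε : ℕ → Ω → L2I) : Prop where
  stationary : IsWeaklyStationary P χ
  noise : IsWhiteNoise P (fun n => ε (n + 1))
  recursion : ∀ n, ∀ᵐ ω ∂P, χ (n + 1) ω = Ψ (χ n ω) + ε (n + 1) ω

/-- The lag-`h` trace-covariogram `σ_tr(h)` of a stationary functional time series. -/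
def traceCovariogram {Ω : Type*} [MeasurableSpace Ω] (P : Measure Ω)
    (χ : ℕ → Ω → L2I) (h : ℕ) : ℝ :=
  traceCov P (χ h) (χ 0)

/-- The functional effective sample size of `χ_1, …, χ_n`:
`n² σ_tr(0) (∑ᵢ ∑ⱼ σ_tr(|i - j|))⁻¹`. -/
def functionalESS {Ω : Type*} [MeasurableSpace Ω] (P : Measure Ω)
    (χ : ℕ → Ω → L2I) (n : ℕ) : ℝ :=
  (n : ℝ) ^ 2 * traceCovariogram P χ 0 *
    (∑ i ∈ Finset.Icc 1 n, ∑ j ∈ Finset.Icc 1 n, traceCovariogram P χ (Nat.dist i j))⁻¹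

/-- The correlation coefficient of two real random variables. -/
def correlation {Ω : Type*} [MeasurableSpace Ω] (P : Measure Ω) (X Y : Ω → ℝ) : ℝ :=
  covariance X Y P / (√(variance X P) * √(variance Y P))

/-- The effective sample size `n² (∑ᵢ ∑ⱼ corr(X_i, X_j))⁻¹` of a scalar sample `X_1, …, X_n`. -/
def scalarESS {Ω : Type*} [MeasurableSpace Ω] (P : Measure Ω) (X : ℕ → Ω → ℝ) (n : ℕ) : ℝ :=
  (n : ℝ) ^ 2 * (∑ i ∈ Finset.Icc 1 n, ∑ j ∈ Finset.Icc 1 n, correlation P (X i) (X j))⁻¹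

/-- The AR(1) effective sample size `n² (∑ᵢ ∑ⱼ a^|i - j|)⁻¹` with autoregressive coefficient `a`. -/
def ar1ESS (a : ℝ) (n : ℕ) : ℝ :=
  (n : ℝ) ^ 2 * (∑ i ∈ Finset.Icc 1 n, ∑ j ∈ Finset.Icc 1 n, a ^ Nat.dist i j)⁻¹

/-- The normalized weights `p_k = η_k²/(1-λ_k²) · (∑ᵣ η_r²/(1-λ_r²))⁻¹`. -/
def farWeight (lam η : ℕ → ℝ) (k : ℕ) : ℝ :=
  η k ^ 2 / (1 - lam k ^ 2) * (∑' r, η r ^ 2 / (1 - lam r ^ 2))⁻¹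

end

/-! Projecting on an eigenfunction with eigenvalue `a` turns the recursion into a scalar AR(1).
Noise is not assumed uncorrelated with the past of `χ`, so the usual Yule–Walker step is
unavailable. Instead, uncorrelated noise at distinct times gives the autocovariance `γ` of the
coordinate a second-order recurrence with solutions `a ^ h` and, for `a ≠ 0`, `a ^ (-h)`;
stationarity bounds `γ` and leaves only the first (`IsStationaryFAR1.coordAutocov_eq`). The noise
variance then fixes `γ 0 = η² / (1 - a²)`. Parseval (`hasSum_traceCov`) sums the coordinates to the
trace-covariance. Since `1 / ESS` is linear in the autocovariances once divided by the variance,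
averaging over coordinates yields the harmonic mean. -/

/-- A bounded sequence `γ` with `γ(h+1) - λ γ(h) = λ (γ(h+2) - λ γ(h+1))`, where `|λ| < 1`, is
geometric with ratio `λ`. -/
theorem eq_pow_mul_of_bounded_of_recurrence {γ : ℕ → ℝ} {a C : ℝ} (ha0 : 0 ≤ a) (ha1 : a < 1)
    (hC : ∀ h, |γ h| ≤ C)
    (hrec : ∀ h, γ (h + 1) - a * γ h = a * (γ (h + 2) - a * γ (h + 1))) (h : ℕ) :
    γ h = a ^ h * γ 0 := by
  -- The defect `γ (h + 1) - a * γ h` equals `a ^ m` times a bounded quantity for every `m`, hence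
  -- vanishes.
  have hiter : ∀ h m, γ (h + 1) - a * γ h = a ^ m * (γ (h + m + 1) - a * γ (h + m)) := by
    intro h m
    induction m with
    | zero => simp
    | succ m ih =>
      rw [ih, hrec (h + m), pow_succ, mul_assoc]
      rfl
  have hzero : ∀ h, γ (h + 1) - a * γ h = 0 := by
    intro h
    have hle : ∀ m : ℕ, |γ (h + 1) - a * γ h| ≤ a ^ m * (C + a * C) := by
      intro m
      rw [hiter h m, abs_mul, abs_of_nonneg (pow_nonneg ha0 m)]
      refine mul_le_mul_of_nonneg_left ((abs_sub _ _).trans ?_) (pow_nonneg ha0 m)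
      rw [abs_mul, abs_of_nonneg ha0]
      exact add_le_add (hC _) (mul_le_mul_of_nonneg_left (hC _) ha0)
    have hlim := (tendsto_pow_atTop_nhds_zero_of_lt_one ha0 ha1).mul_const (C + a * C)
    rw [zero_mul] at hlim
    exact abs_nonpos_iff.1 (ge_of_tendsto' hlim hle)
  induction h with
  | zero => simp
  | succ h ih =>
    rw [sub_eq_zero.1 (hzero h), ih, pow_succ]
    ring

/-- The eigenvalues of an integral operator with positive kernel are non-negative. -/
theorem IsIntegralOperator.eigenvalue_nonneg {ψ : unitInterval → unitInterval → ℝ}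
    (hψ : IsPositiveKernel ψ) {Ψ : L2I →L[ℝ] L2I} (hΨ : IsIntegralOperator ψ Ψ) {f : L2I} {a : ℝ}
    (hf : ‖f‖ = 1) (hfa : Ψ f = a • f) : 0 ≤ a := by
  have h1 : a = inner ℝ f (Ψ f) := by
    rw [hfa, real_inner_smul_right, real_inner_self_eq_norm_sq, hf]; ring
  have h2 : inner ℝ f (Ψ f) = ∫ t, ∫ s, ψ t s * f s * f t := by
    rw [L2.inner_def]
    refine integral_congr_ae ?_
    filter_upwards [hΨ f] with t ht
    rw [integral_mul_const, ← ht]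
    rfl
  rw [h1, h2]
  exact hψ.positive f

theorem abs_lt_one_of_eigenvector {H : Type*} [NormedAddCommGroup H] [NormedSpace ℝ H]
    {T : H →L[ℝ] H} (hT : ‖T‖ < 1) {f : H} {a : ℝ} (hf : ‖f‖ = 1) (hfa : T f = a • f) :
    |a| < 1 := by
  have h := T.le_opNorm f
  rw [hfa, norm_smul, hf, mul_one, mul_one, Real.norm_eq_abs] at h
  exact h.trans_lt hT

/-! ### Covariance operators and Parseval's identity -/

section Covariance

variable {Ω : Type*} [MeasurableSpace Ω] {P : Measure Ω}

/-- The centred coordinate `⟨X - E X, f⟩` of a random element of `L²([0,1])`. -/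
noncomputable def centredCoord (P : Measure Ω) (X : Ω → L2I) (f : L2I) (ω : Ω) : ℝ :=
  inner ℝ (X ω - ∫ ω', X ω' ∂P) f

theorem memLp_centredCoord [IsFiniteMeasure P] {X : Ω → L2I} (hX : MemLp X 2 P) (f : L2I) :
    MemLp (centredCoord P X f) 2 P :=
  (hX.sub (memLp_const _)).inner_const f

theorem integrable_centredCoord_mul [IsFiniteMeasure P] {X Y : Ω → L2I} (hX : MemLp X 2 P)
    (hY : MemLp Y 2 P) (f g : L2I) :
    Integrable (fun ω => centredCoord P X f ω * centredCoord P Y g ω) P :=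
  (memLp_centredCoord hX f).integrable_mul (memLp_centredCoord hY g)

/-- The quadratic form of the covariance operator is the covariance of the coordinates. -/
theorem inner_covOp [IsFiniteMeasure P] {X Y : Ω → L2I} (hX : MemLp X 2 P) (hY : MemLp Y 2 P)
    (f g : L2I) :
    inner ℝ (covOp P X Y f) g = ∫ ω, centredCoord P X f ω * centredCoord P Y g ω ∂P := by
  have hint : Integrable (fun ω => centredCoord P X f ω • (Y ω - ∫ ω', Y ω' ∂P)) P :=
    memLp_one_iff_integrable.1
      (MemLp.smul (p := 2) (q := 2) (hY.sub (memLp_const _)) (memLp_centredCoord hX f))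
  rw [real_inner_comm]
  refine (integral_inner hint g).symm.trans (integral_congr_ae (Filter.Eventually.of_forall ?_))
  intro ω
  simp only [real_inner_smul_right, centredCoord]
  rw [real_inner_comm g]

/-- AM-GM suffices in place of Cauchy–Schwarz: under stationarity both second moments agree. -/
theorem abs_integral_mul_le {X Y : Ω → ℝ} (hX : MemLp X 2 P) (hY : MemLp Y 2 P) :
    |∫ ω, X ω * Y ω ∂P| ≤ ((∫ ω, X ω * X ω ∂P) + ∫ ω, Y ω * Y ω ∂P) / 2 := by
  have hXX : Integrable (fun ω => X ω * X ω) P := hX.integrable_mul hX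
  have hYY : Integrable (fun ω => Y ω * Y ω) P := hY.integrable_mul hY
  have hXY : Integrable (fun ω => X ω * Y ω) P := hX.integrable_mul hY
  rw [← integral_add hXX hYY, ← integral_div]
  refine (abs_integral_le_integral_abs).trans
    (integral_mono hXY.abs ((hXX.add hYY).div_const 2) fun ω => ?_)
  simp only [abs_le]
  constructor <;> nlinarith [sq_nonneg (X ω + Y ω), sq_nonneg (X ω - Y ω)]

/-- The expected inner product is the sum of the expected products of the coordinates. -/
theorem hasSum_integral_inner {H : Type*} [NormedAddCommGroup H] [InnerProductSpace ℝ H]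
    (φ : HilbertBasis ℕ ℝ H) {X Y : Ω → H} (hX : MemLp X 2 P) (hY : MemLp Y 2 P) :
    HasSum (fun k => ∫ ω, inner ℝ (X ω) (φ k) * inner ℝ (Y ω) (φ k) ∂P)
      (∫ ω, inner ℝ (X ω) (Y ω) ∂P) := by
  have hsq : ∀ x : H, HasSum (fun k => inner ℝ x (φ k) * inner ℝ x (φ k)) (‖x‖ ^ 2) := by
    intro x
    have h := φ.hasSum_inner_mul_inner x x
    simp_rw [real_inner_self_eq_norm_sq, real_inner_comm x] at h
    exact h
  have hbd : ∀ ω, HasSum (fun k => (inner ℝ (X ω) (φ k) * inner ℝ (X ω) (φ k) +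
      inner ℝ (Y ω) (φ k) * inner ℝ (Y ω) (φ k)) / 2) ((‖X ω‖ ^ 2 + ‖Y ω‖ ^ 2) / 2) :=
    fun ω => ((hsq (X ω)).add (hsq (Y ω))).div_const 2
  -- By AM-GM each product is dominated by half a sum of squares; by Parseval these bounds add up to
  -- `(‖X‖² + ‖Y‖²) / 2`, which is integrable.
  refine hasSum_integral_of_dominated_convergence
    (fun k ω => (inner ℝ (X ω) (φ k) * inner ℝ (X ω) (φ k) +
      inner ℝ (Y ω) (φ k) * inner ℝ (Y ω) (φ k)) / 2) ?_ ?_ ?_ ?_ ?_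
  · exact fun k => (hX.inner_const (φ k)).1.mul (hY.inner_const (φ k)).1
  · intro k
    refine Filter.Eventually.of_forall fun ω => ?_
    rw [Real.norm_eq_abs, abs_le]
    constructor <;>
      nlinarith [sq_nonneg (inner ℝ (X ω) (φ k) + inner ℝ (Y ω) (φ k)),
        sq_nonneg (inner ℝ (X ω) (φ k) - inner ℝ (Y ω) (φ k))]
  · exact Filter.Eventually.of_forall fun ω => (hbd ω).summable
  · simp_rw [fun ω => (hbd ω).tsum_eq]
    exact ((hX.integrable_norm_pow two_ne_zero).add
      (hY.integrable_norm_pow two_ne_zero)).div_const 2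
  · refine Filter.Eventually.of_forall fun ω => ?_
    have h := φ.hasSum_inner_mul_inner (X ω) (Y ω)
    simpa only [real_inner_comm (Y ω) (φ _)] using h

/-- The trace-covariance is the trace of the covariance operator, so it inherits stationarity from
it. -/
theorem hasSum_traceCov [IsFiniteMeasure P] (φ : HilbertBasis ℕ ℝ L2I) {X Y : Ω → L2I}
    (hX : MemLp X 2 P) (hY : MemLp Y 2 P) :
    HasSum (fun k => inner ℝ (covOp P X Y (φ k)) (φ k)) (traceCov P X Y) := by
  simp_rw [inner_covOp hX hY]
  exact hasSum_integral_inner φ (hX.sub (memLp_const _)) (hY.sub (memLp_const _))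

end Covariance

/-! ### Second-order structure of the coordinate processes -/

section FAR

variable {Ω : Type*} [MeasurableSpace Ω] {P : Measure Ω} [IsProbabilityMeasure P]
  {Ψ : L2I →L[ℝ] L2I} {χ ε : ℕ → Ω → L2I}

/-- The autocovariance at lag `h` of the coordinate process `⟨χ_n, f⟩`. -/
noncomputable def coordAutocov (P : Measure Ω) (χ : ℕ → Ω → L2I) (f : L2I) (h : ℕ) : ℝ :=
  inner ℝ (covOp P (χ h) (χ 0) f) f

theorem IsWeaklyStationary.integral_centredCoord_mul (hχ : IsWeaklyStationary P χ) (f : L2I)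
    (i j : ℕ) :
    ∫ ω, centredCoord P (χ i) f ω * centredCoord P (χ j) f ω ∂P =
      coordAutocov P χ f (Nat.dist i j) := by
  wlog hij : j ≤ i generalizing i j
  · rw [Nat.dist_comm, ← this j i (le_of_not_ge hij)]
    simp_rw [mul_comm]
  rw [coordAutocov, ← inner_covOp (hχ.memLp i) (hχ.memLp j), hχ.cov i j (Nat.dist i j) 0]
  rw [Nat.dist_eq_sub_of_le_right hij]
  push_cast [hij]
  ring

/-- Allows centring the recursion without computing the mean. -/
theorem IsStationaryFAR1.mean_succ (hχ : IsStationaryFAR1 P Ψ χ ε) (n : ℕ) :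
    ∫ ω, χ (n + 1) ω ∂P = Ψ (∫ ω, χ n ω ∂P) := by
  have hi : Integrable (χ n) P := (hχ.stationary.memLp n).integrable one_le_two
  have hε : Integrable (ε (n + 1)) P := (hχ.noise.memLp n).integrable one_le_two
  rw [integral_congr_ae (hχ.recursion n), integral_add (Ψ.integrable_comp hi) hε,
    hχ.noise.mean n, add_zero, Ψ.integral_comp_comm hi]

theorem IsStationaryFAR1.noise_coord (hχ : IsStationaryFAR1 P Ψ χ ε)
    {f : L2I} {a : ℝ} (hΨ : ∀ g, inner ℝ (Ψ g) f = a * inner ℝ g f) (n : ℕ) :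
    ∀ᵐ ω ∂P, inner ℝ (ε (n + 1) ω) f =
      centredCoord P (χ (n + 1)) f ω - a * centredCoord P (χ n) f ω := by
  filter_upwards [hχ.recursion n] with ω hω
  rw [centredCoord, centredCoord, hχ.mean_succ, hω, ← hΨ, ← inner_sub_left, map_sub]
  congr 1
  abel

/-- The covariances of the noise coordinates in terms of the autocovariances. -/
theorem IsStationaryFAR1.integral_noise_coord_mul (hχ : IsStationaryFAR1 P Ψ χ ε)
    {f : L2I} {a : ℝ} (hΨ : ∀ g, inner ℝ (Ψ g) f = a * inner ℝ g f) (m n : ℕ) :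
    ∫ ω, inner ℝ (ε (m + 1) ω) f * inner ℝ (ε (n + 1) ω) f ∂P =
      (1 + a ^ 2) * coordAutocov P χ f (Nat.dist m n) -
        a * coordAutocov P χ f (Nat.dist (m + 1) n) -
        a * coordAutocov P χ f (Nat.dist m (n + 1)) := by
  have hI : ∀ i j, Integrable (fun ω => centredCoord P (χ i) f ω * centredCoord P (χ j) f ω) P :=
    fun i j => integrable_centredCoord_mul (hχ.stationary.memLp i) (hχ.stationary.memLp j) f f
  have hae : (fun ω => inner ℝ (ε (m + 1) ω) f * inner ℝ (ε (n + 1) ω) f) =ᵐ[P] fun ω =>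
      centredCoord P (χ (m + 1)) f ω * centredCoord P (χ (n + 1)) f ω +
        a ^ 2 * (centredCoord P (χ m) f ω * centredCoord P (χ n) f ω) -
        a * (centredCoord P (χ (m + 1)) f ω * centredCoord P (χ n) f ω) -
        a * (centredCoord P (χ m) f ω * centredCoord P (χ (n + 1)) f ω) := by
    filter_upwards [hχ.noise_coord hΨ m, hχ.noise_coord hΨ n] with ω h1 h2
    rw [h1, h2]
    ring
  rw [integral_congr_ae hae, integral_sub, integral_sub, integral_add, integral_const_mul,
    integral_const_mul, integral_const_mul]
  · simp_rw [hχ.stationary.integral_centredCoord_mul, Nat.dist_add_add_right]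
    ring
  · exact hI _ _
  · exact (hI _ _).const_mul _
  · exact (hI _ _).add ((hI _ _).const_mul _)
  · exact (hI _ _).const_mul _
  · exact ((hI _ _).add ((hI _ _).const_mul _)).sub ((hI _ _).const_mul _)
  · exact (hI _ _).const_mul _

theorem IsStationaryFAR1.noise_coord_uncorrelated (hχ : IsStationaryFAR1 P Ψ χ ε)
    (f : L2I) {m n : ℕ} (hmn : m ≠ n) :
    ∫ ω, inner ℝ (ε (m + 1) ω) f * inner ℝ (ε (n + 1) ω) f ∂P = 0 := by
  have h := inner_covOp (hχ.noise.memLp m) (hχ.noise.memLp n) f f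
  rw [hχ.noise.uncorrelated m n hmn] at h
  simpa [centredCoord, hχ.noise.mean] using h.symm

/-- The coordinates of a stationary FAR(1) process along eigenvectors have the autocovariances of
a causal AR(1) process. -/
theorem IsStationaryFAR1.coordAutocov_eq (hχ : IsStationaryFAR1 P Ψ χ ε)
    {f : L2I} {a : ℝ} (ha0 : 0 ≤ a) (ha1 : a < 1)
    (hΨ : ∀ g, inner ℝ (Ψ g) f = a * inner ℝ g f) (h : ℕ) :
    coordAutocov P χ f h = a ^ h * coordAutocov P χ f 0 := by
  have hd : ∀ n : ℕ, Nat.dist n 0 = n := fun n => by simp [Nat.dist]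
  refine eq_pow_mul_of_bounded_of_recurrence (C := coordAutocov P χ f 0) ha0 ha1 ?_ ?_ h
  · intro h
    have hle := abs_integral_mul_le (memLp_centredCoord (hχ.stationary.memLp h) f)
      (memLp_centredCoord (hχ.stationary.memLp 0) f)
    simpa [hχ.stationary.integral_centredCoord_mul, hd, Nat.dist_self] using hle
  · intro h
    -- The noises at times `h + 2` and `1` are uncorrelated; the lags that appear are `h + 1`, `h +
    -- 2` and `h`.
    have h0 := hχ.integral_noise_coord_mul hΨ (h + 1) 0
    rw [hχ.noise_coord_uncorrelated f (Nat.succ_ne_zero h), Nat.dist_add_add_right, hd, hd,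
      hd] at h0
    linarith

/-- At equal times the noise variance is `(1 + a²) γ(0) - 2 a γ(1)`, and `γ(1) = a γ(0)`. -/
theorem IsStationaryFAR1.integral_noise_coord_sq (hχ : IsStationaryFAR1 P Ψ χ ε)
    {f : L2I} {a : ℝ} (ha0 : 0 ≤ a) (ha1 : a < 1)
    (hΨ : ∀ g, inner ℝ (Ψ g) f = a * inner ℝ g f) (n : ℕ) :
    ∫ ω, inner ℝ (ε (n + 1) ω) f ^ 2 ∂P = (1 - a ^ 2) * coordAutocov P χ f 0 := by
  have h0 := hχ.integral_noise_coord_mul hΨ n n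
  have h1 : Nat.dist (n + 1) n = 1 := by simp [Nat.dist]
  have h2 : Nat.dist n (n + 1) = 1 := by simp [Nat.dist]
  rw [h1, h2, Nat.dist_self, hχ.coordAutocov_eq ha0 ha1 hΨ 1] at h0
  simp_rw [sq (inner ℝ _ f)]
  rw [h0]
  ring

theorem covariance_inner {X Y : Ω → L2I} (hX : MemLp X 2 P) (hY : MemLp Y 2 P) (f : L2I) :
    covariance (fun ω => inner ℝ (X ω) f) (fun ω => inner ℝ (Y ω) f) P =
      ∫ ω, centredCoord P X f ω * centredCoord P Y f ω ∂P := by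
  have hmean : ∀ Z : Ω → L2I, MemLp Z 2 P →
      ∫ ω, inner ℝ (Z ω) f ∂P = inner ℝ (∫ ω, Z ω ∂P) f := by
    intro Z hZ
    rw [real_inner_comm, ← integral_inner (hZ.integrable one_le_two) f]
    simp_rw [real_inner_comm]
  rw [covariance, hmean X hX, hmean Y hY]
  simp_rw [centredCoord, inner_sub_left]

/-- The autocorrelations of the coordinates of a stationary FAR(1) process along eigenvectors. -/
theorem IsStationaryFAR1.correlation_coord (hχ : IsStationaryFAR1 P Ψ χ ε)
    {f : L2I} {a : ℝ} (ha0 : 0 ≤ a) (ha1 : a < 1)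
    (hΨ : ∀ g, inner ℝ (Ψ g) f = a * inner ℝ g f) (hpos : 0 < coordAutocov P χ f 0) (i j : ℕ) :
    correlation P (fun ω => inner ℝ (χ i ω) f) (fun ω => inner ℝ (χ j ω) f) =
      a ^ Nat.dist i j := by
  have hm : ∀ i, AEMeasurable (fun ω => inner ℝ (χ i ω) f) P := fun i =>
    ((hχ.stationary.memLp i).inner_const f).1.aemeasurable
  have hcov : ∀ i j, covariance (fun ω => inner ℝ (χ i ω) f) (fun ω => inner ℝ (χ j ω) f) P =
      coordAutocov P χ f (Nat.dist i j) := fun i j => by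
    rw [covariance_inner (hχ.stationary.memLp i) (hχ.stationary.memLp j),
      hχ.stationary.integral_centredCoord_mul]
  rw [correlation, ← covariance_self (hm i), ← covariance_self (hm j), hcov, hcov, hcov,
    Nat.dist_self, Nat.dist_self, Real.mul_self_sqrt hpos.le, hχ.coordAutocov_eq ha0 ha1 hΨ,
    mul_div_cancel_right₀ _ hpos.ne']

end FAR

/-! ### Effective sample sizes and the main theorem -/

theorem sum_sum_dist_pos {c : ℕ → ℝ} (hc0 : 0 < c 0) (hc : ∀ h, 0 ≤ c h) {n : ℕ} (hn : 1 ≤ n) :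
    0 < ∑ i ∈ Finset.Icc 1 n, ∑ j ∈ Finset.Icc 1 n, c (Nat.dist i j) := by
  have h1 : 1 ∈ Finset.Icc 1 n := Finset.mem_Icc.2 ⟨le_rfl, hn⟩
  refine Finset.sum_pos' (fun i _ => Finset.sum_nonneg fun j _ => hc _) ⟨1, h1, ?_⟩
  refine Finset.sum_pos' (fun j _ => hc _) ⟨1, h1, ?_⟩
  rwa [Nat.dist_self]

theorem ar1ESS_pos {a : ℝ} (ha : 0 ≤ a) {n : ℕ} (hn : 1 ≤ n) : 0 < ar1ESS a n := by
  have hn' : (0 : ℝ) < n := by exact_mod_cast hn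
  exact mul_pos (pow_pos hn' 2)
    (inv_pos.2 (sum_sum_dist_pos (c := fun h => a ^ h) (by simp) (fun h => pow_nonneg ha h) hn))

theorem mainTheorem4 {Ω : Type*} [MeasurableSpace Ω] (P : Measure Ω) [IsProbabilityMeasure P]
    (ψ : unitInterval → unitInterval → ℝ) (hψ : IsPositiveKernel ψ)
    (Ψ : L2I →L[ℝ] L2I) (hΨ : IsIntegralOperator ψ Ψ) (hΨ_norm : ‖Ψ‖ < 1)
    (lam : ℕ → ℝ) (φ : HilbertBasis ℕ ℝ L2I) (h_eigen : ∀ k, Ψ (φ k) = lam k • φ k)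
    (χ ε : ℕ → Ω → L2I) (hχ : IsStationaryFAR1 P Ψ χ ε)
    (η : ℕ → ℝ) (hη : ∀ n k, η k ^ 2 = ∫ ω, (inner ℝ (ε (n + 1) ω) (φ k)) ^ 2 ∂P) :
    -- the eigenvalues lie in `[0, 1)`, so that all the denominators below are positive
    (∀ k, 0 ≤ lam k ∧ lam k < 1) ∧
    -- `σ_tr(h)` does not depend on the time point and equals `∑ₖ λ_k^h η_k² / (1 - λ_k²)`
    (∀ m h : ℕ, traceCov P (χ (m + h)) (χ m) = traceCovariogram P χ h) ∧
    (∀ h : ℕ, HasSum (fun k => lam k ^ h * (η k ^ 2 / (1 - lam k ^ 2)))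
      (traceCovariogram P χ h)) ∧
    -- the `p_k` are weights
    (∀ k, 0 ≤ farWeight lam η k) ∧ HasSum (farWeight lam η) 1 ∧
    (∀ n : ℕ, 1 ≤ n →
      -- `ESS_k` is the effective sample size of the scalar process `⟨χ_n, φ_k⟩`
      (∀ k, 0 < ar1ESS (lam k) n) ∧
      (∀ k, η k ≠ 0 →
        scalarESS P (fun m ω => inner ℝ (χ m ω) (φ k)) n = ar1ESS (lam k) n) ∧
      -- the functional effective sample size is the weighted harmonic mean of the `ESS_k`
      0 < functionalESS P χ n ∧
      Summable (fun k => farWeight lam η k / ar1ESS (lam k) n) ∧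
      functionalESS P χ n = (∑' k, farWeight lam η k / ar1ESS (lam k) n)⁻¹) := by
  have hnorm : ∀ k, ‖φ k‖ = 1 := φ.orthonormal.1
  have hlam0 : ∀ k, 0 ≤ lam k := fun k => hΨ.eigenvalue_nonneg hψ (hnorm k) (h_eigen k)
  have hlam1 : ∀ k, lam k < 1 := fun k =>
    (abs_lt.1 (abs_lt_one_of_eigenvector hΨ_norm (hnorm k) (h_eigen k))).2
  have hden : ∀ k, 0 < 1 - lam k ^ 2 := fun k =>
    sub_pos.2 (pow_lt_one₀ (hlam0 k) (hlam1 k) two_ne_zero)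
  -- Expanding `g` in the eigenbasis shows that `φ k` is also an eigenvector of the adjoint.
  have hcoord : ∀ k g, inner ℝ (Ψ g) (φ k) = lam k * inner ℝ g (φ k) := by
    intro k g
    have h1 := (φ.hasSum_repr g).mapL Ψ
    have h2 := h1.mapL (innerSL ℝ (φ k))
    have h3 : ∀ i, innerSL ℝ (φ k) (Ψ (φ.repr g i • φ i)) =
        if i = k then lam k * inner ℝ g (φ k) else 0 := by
      intro i
      rw [map_smul, h_eigen, innerSL_apply_apply, real_inner_smul_right, real_inner_smul_right,
        orthonormal_iff_ite.1 φ.orthonormal, φ.repr_apply_apply]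
      by_cases hik : i = k
      · subst hik
        simp [real_inner_comm, mul_comm]
      · simp [hik, Ne.symm hik]
    simp_rw [h3] at h2
    rw [real_inner_comm]
    exact h2.unique (hasSum_ite_eq k _)
  have hcov0 : ∀ k, coordAutocov P χ (φ k) 0 = η k ^ 2 / (1 - lam k ^ 2) := fun k => by
    rw [hη 0 k, hχ.integral_noise_coord_sq (hlam0 k) (hlam1 k) (hcoord k),
      mul_div_cancel_left₀ _ (hden k).ne']
  have hsum : ∀ h : ℕ, HasSum (fun k => lam k ^ h * (η k ^ 2 / (1 - lam k ^ 2)))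
      (traceCovariogram P χ h) := fun h => by
    refine (hasSum_traceCov φ (hχ.stationary.memLp h) (hχ.stationary.memLp 0)).congr_fun ?_
    intro k
    rw [← hcov0, ← hχ.coordAutocov_eq (hlam0 k) (hlam1 k) (hcoord k)]
    rfl
  have hw0 : ∀ k, 0 ≤ η k ^ 2 / (1 - lam k ^ 2) := fun k => div_nonneg (sq_nonneg _) (hden k).le
  have hσ0 : HasSum (fun k => η k ^ 2 / (1 - lam k ^ 2)) (traceCovariogram P χ 0) := by
    simpa using hsum 0
  have hσnonneg : ∀ h, 0 ≤ traceCovariogram P χ h := fun h =>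
    (hsum h).nonneg fun k => mul_nonneg (pow_nonneg (hlam0 k) h) (hw0 k)
  have hσpos : 0 < traceCovariogram P χ 0 := by
    obtain ⟨k, hk⟩ : ∃ k, η k ≠ 0 := by
      -- If every `η k` vanished, Parseval would give `E‖ε 1‖² = 0`, contradicting nondegeneracy.
      by_contra! hall
      have hs := hasSum_integral_inner φ (hχ.noise.memLp 0) (hχ.noise.memLp 0)
      have hz : ∀ k, ∫ ω, inner ℝ (ε (0 + 1) ω) (φ k) * inner ℝ (ε (0 + 1) ω) (φ k) ∂P = 0 := by
        intro k
        simp_rw [← sq]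
        rw [← hη 0 k, hall k]
        simp
      simp_rw [hz, real_inner_self_eq_norm_sq] at hs
      exact (hχ.noise.nondegenerate 0).ne (hasSum_zero.unique hs)
    rw [← hσ0.tsum_eq]
    exact hσ0.summable.tsum_pos hw0 k (div_pos (by positivity) (hden k))
  have hweight : ∀ k, farWeight lam η k =
      η k ^ 2 / (1 - lam k ^ 2) * (traceCovariogram P χ 0)⁻¹ := fun k => by
    rw [farWeight, hσ0.tsum_eq]
  refine ⟨fun k => ⟨hlam0 k, hlam1 k⟩, ?_, hsum, ?_, ?_, fun n hn => ?_⟩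
  · intro m h
    refine (hasSum_traceCov φ (hχ.stationary.memLp (m + h)) (hχ.stationary.memLp m)).unique ?_
    rw [hχ.stationary.cov (m + h) m h 0 (by push_cast; ring)]
    exact hasSum_traceCov φ (hχ.stationary.memLp h) (hχ.stationary.memLp 0)
  · intro k
    rw [hweight]
    exact mul_nonneg (hw0 k) (inv_nonneg.2 hσpos.le)
  · simp_rw [funext hweight]
    have h := hσ0.mul_right (traceCovariogram P χ 0)⁻¹
    rwa [mul_inv_cancel₀ hσpos.ne'] at h
  have hn' : (0 : ℝ) < n := by exact_mod_cast hn
  have hS : 0 < ∑ i ∈ Finset.Icc 1 n, ∑ j ∈ Finset.Icc 1 n,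
      traceCovariogram P χ (Nat.dist i j) := sum_sum_dist_pos hσpos hσnonneg hn
  -- Working with reciprocals puts the double sum in the numerator, where it commutes with the
  -- series over `k`.
  have hESS : HasSum (fun k => farWeight lam η k / ar1ESS (lam k) n) (functionalESS P χ n)⁻¹ := by
    have h1 : HasSum (fun k => ∑ i ∈ Finset.Icc 1 n, ∑ j ∈ Finset.Icc 1 n,
        lam k ^ Nat.dist i j * (η k ^ 2 / (1 - lam k ^ 2)))
        (∑ i ∈ Finset.Icc 1 n, ∑ j ∈ Finset.Icc 1 n, traceCovariogram P χ (Nat.dist i j)) :=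
      hasSum_sum fun i _ => hasSum_sum fun j _ => hsum _
    have h2 := h1.mul_left (((n : ℝ) ^ 2 * traceCovariogram P χ 0)⁻¹)
    rw [functionalESS, mul_inv, inv_inv]
    refine h2.congr_fun fun k => ?_
    simp_rw [← Finset.sum_mul]
    rw [hweight, ar1ESS, div_eq_mul_inv, mul_inv, inv_inv, mul_inv]
    ring
  refine ⟨fun k => ar1ESS_pos (hlam0 k) hn, fun k hk => ?_, ?_, hESS.summable, ?_⟩
  · have hpos : 0 < coordAutocov P χ (φ k) 0 := by
      rw [hcov0]
      exact div_pos (by positivity) (hden k)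
    simp_rw [scalarESS, hχ.correlation_coord (hlam0 k) (hlam1 k) (hcoord k) hpos]
    rfl
  · exact mul_pos (mul_pos (pow_pos hn' 2) hσpos) (inv_pos.2 hS)
  · rw [hESS.tsum_eq, inv_inv]
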